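/- All graphs are finite and simple. For a graph $X$ with adjacency matrix $A$, let $E_\theta$ denote the orthogonal projection of $\mathbb{C}^{V(X)}$ onto the $\theta$-eigenspace of $A$, let $e_a$ denote the standard basis vector of a vertex $a$, and let $U_X(t)=\exp(-itA)$ for $t\in\mathbb{R}$. Vertices $a,b$ of $X$ are strongly cospectral if for every eigenvalue $\theta$ of $A$ one has $E_\theta e_a=E_\theta e_b$ or $E_\theta e_a=-E_\theta e_b$. There is pretty good state transfer from $a$ to $b$ if for every $\epsilon>0$ there is $\tau\in\mathbb{R}$ with $|U_X(\tau)_{b,a}|>1-\epsilon$. Let $P_n$ be the path with vertices $1,\dots,n$ in order, and let $F_{n+1}$ be the field generated over $\mathbb{Q}$ by the eigenvalues of the adjacency matrix of $P_n$. For a graph $Z$, let $F_Z$ be the field generated over $\mathbb{Q}$ by the eigenvalues of the adjacency matrix of $Z$. Let $n\ge 1$ be an integer such that one of the following holds: (i) $n+1=p$ for a prime $p\equiv 1\pmod 8$; (ii) $n+1=2p$ for a prime $p\equiv 1\pmod 4$; (iii) $n+1=2^e$ for an integer $e\geq 1$. Let $Z$ be a graph with $F_{n+1}\cap F_Z=\mathbb{Q}$,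 and let $z$ be a vertex of $Z$. If $(1,z)$ and $(n,z)$ are strongly cospectral in the cartesian product $P_n\,\square\,Z$, then there is pretty good state transfer between $(1,z)$ and $(n,z)$ in $P_n\,\square\,Z$, that is, both from $(1,z)$ to $(n,z)$ and from $(n,z)$ to $(1,z)$. -/

import Mathlib

/-! Continuous-time quantum walks on finite simple graphs (with the adjacency matrix as
Hamiltonian), their eigenprojections, strong cospectrality and pretty good state transfer. -/

namespace QuantumWalk

noncomputable section

variable {V : Type*} [Fintype V] [DecidableEq V] (G : SimpleGraph V) [DecidableRel G.Adj]

/-- The adjacency matrix of `G`, acting on the Hilbert space `ℂ^V`. -/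
def adjOp : Module.End ℂ (EuclideanSpace ℂ V) :=
  Matrix.toEuclideanLin (G.adjMatrix ℂ)

/-- The set of (distinct) eigenvalues of the adjacency matrix of `G`. -/
def eigenvalues : Set ℂ :=
  {θ : ℂ | Module.End.HasEigenvalue (adjOp G) θ}

/-- The field generated over `ℚ` by the eigenvalues of `G`, as a subfield of `ℂ`. -/
def eigenvalueField : IntermediateField ℚ ℂ :=
  IntermediateField.adjoin ℚ (eigenvalues G)

/-- The orthogonal projection `E_θ` of `ℂ^V` onto the `θ`-eigenspace of the adjacency matrix. -/
def eigenProj (θ : ℂ) : EuclideanSpace ℂ V →L[ℂ] EuclideanSpace ℂ V :=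
  (Module.End.eigenspace (adjOp G) θ).starProjection

/-- Vertices `a`, `b` are strongly cospectral: `E_θ e_a = ± E_θ e_b` for every eigenvalue `θ`,
where the sign may depend on `θ`. -/
def StronglyCospectral (a b : V) : Prop :=
  ∀ θ ∈ eigenvalues G,
    eigenProj G θ (EuclideanSpace.single a 1) = eigenProj G θ (EuclideanSpace.single b 1) ∨
    eigenProj G θ (EuclideanSpace.single a 1) = -eigenProj G θ (EuclideanSpace.single b 1)

/-- The transition matrix `U(t) = exp(-i t A)` of the continuous-time quantum walk on `G`. -/
def transitionMatrix (t : ℝ) : Matrix V V ℂ :=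
  NormedSpace.exp ((-(Complex.I * (t : ℂ))) • G.adjMatrix ℂ)

/-- Pretty good state transfer from `a` to `b`: for every `ε > 0` there is a real time `τ`
with `|U(τ)_{b,a}| > 1 - ε`. -/
def PrettyGoodStateTransfer (a b : V) : Prop :=
  ∀ ε : ℝ, 0 < ε → ∃ τ : ℝ, 1 - ε < ‖transitionMatrix G τ b a‖

/-- The first vertex of the path `P_n` on `n ≥ 1` vertices (written `1` on paper). -/
def firstVertex (n : ℕ) (hn : 0 < n) : Fin n := ⟨0, hn⟩

/-- The last vertex of the path `P_n` on `n ≥ 1` vertices (written `n` on paper). -/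
def lastVertex (n : ℕ) (hn : 0 < n) : Fin n := ⟨n - 1, Nat.sub_lt hn Nat.one_pos⟩

/-- Adjacency in the path `0 - 1 - ... - (n-1)` is decidable. -/
instance pathGraphDecidableAdj (n : ℕ) : DecidableRel (SimpleGraph.pathGraph n).Adj :=
  fun _ _ => decidable_of_iff' _ SimpleGraph.pathGraph_adj

/-- Adjacency in a cartesian product of graphs is decidable. -/
instance boxProdDecidableAdj {α β : Type*} [DecidableEq α] [DecidableEq β]
    (G : SimpleGraph α) (H : SimpleGraph β) [DecidableRel G.Adj] [DecidableRel H.Adj] :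
    DecidableRel (SimpleGraph.boxProd G H).Adj :=
  fun _ _ => decidable_of_iff' _ SimpleGraph.boxProd_adj

end

end QuantumWalk

namespace QuantumWalk

open scoped Matrix Kronecker

/-! Diagonalizing both factors gives `U(t)_{(n,z),(1,z)} = ∑ w_j v_r (-1)^(j-1) exp(-it(λ_j +
μ_r))`, where `λ_j = 2cos(πj/(n+1))` for `1 ≤ j ≤ n`, the `μ_r` are eigenvalues of `Z`, and the
nonnegative weights `w_j v_r` sum to 1. Such a sum has modulus arbitrarily close to 1 as soon as the
signs respect every integer relation with coefficient sum zero among the frequencies. This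
Kronecker-type criterion is `exists_norm_signed_exp_sum_gt`, proved by expanding high powers of the
sum.

For a relation `l`, put `a_j = ∑_r l_{jr}` and `b_r = ∑_j l_{jr}`. Then `∑ a_j λ_j = -∑ b_r μ_r`
lies in both eigenvalue fields, so it is rational, and `∑ a_j = 0`. It remains to see that the sum
of `a_j` over even `j` is even. This is cyclotomic arithmetic: linear relations between roots of
unity of order `p`, `4p` or `2^(e+1)` are rigid enough to decide the parity in each of the three
cases.

Transfer in the reverse direction follows because `U(t)` is symmetric. -/

/-! ### Exponential sums of modulus close to one -/

theorem norm_const_le_of_exp_sum_bounded {ι : Type*} (S : Finset ι) (μ : ι → ℝ)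
    (hμ : ∀ i ∈ S, μ i ≠ 0) (c₀ : ℂ) (c : ι → ℂ) (B : ℝ)
    (h : ∀ t : ℝ, ‖c₀ + ∑ i ∈ S, c i * Complex.exp (Complex.I * (μ i * t))‖ ≤ B) :
    ‖c₀‖ ≤ B := by
  classical
  induction S using Finset.induction_on generalizing c with
  | empty => simpa using h 0
  | insert k S hk ih =>
    have hk0 : μ k ≠ 0 := hμ k (Finset.mem_insert_self _ _)
    -- Averaging the values at `t` and `t + u` preserves the bound and the constant term, and kills
    -- the `k`-th term because `exp(i μ_k u) = -1`.
    set u : ℝ := Real.pi / μ k with hu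
    have hexp : Complex.exp (Complex.I * (μ k * u)) = -1 := by
      have : Complex.I * ((μ k : ℂ) * (u : ℂ)) = Real.pi * Complex.I := by
        have h1 : μ k * u = Real.pi := by rw [hu]; field_simp
        rw [← Complex.ofReal_mul, h1, mul_comm]
      rw [this, Complex.exp_pi_mul_I]
    refine ih (fun i hi => hμ i (Finset.mem_insert_of_mem hi))
      (fun i => c i * ((1 + Complex.exp (Complex.I * (μ i * u))) / 2)) fun t => ?_
    have hsplit : ∀ i, Complex.exp (Complex.I * (μ i * ((t + u : ℝ) : ℂ)))
        = Complex.exp (Complex.I * (μ i * t)) * Complex.exp (Complex.I * (μ i * u)) := by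
      intro i
      rw [← Complex.exp_add]
      congr 1
      push_cast
      ring
    have key : c₀ + ∑ i ∈ S, c i * ((1 + Complex.exp (Complex.I * (μ i * u))) / 2) *
          Complex.exp (Complex.I * (μ i * t))
        = ((c₀ + ∑ i ∈ insert k S, c i * Complex.exp (Complex.I * (μ i * t))) +
          (c₀ + ∑ i ∈ insert k S, c i * Complex.exp (Complex.I * (μ i * ((t + u : ℝ) : ℂ))))) / 2 := by
      simp_rw [hsplit]
      rw [Finset.sum_insert hk, Finset.sum_insert hk, hexp]
      have : ∑ i ∈ S, c i * ((1 + Complex.exp (Complex.I * (μ i * u))) / 2) *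
          Complex.exp (Complex.I * (μ i * t)) =
          (∑ i ∈ S, c i * Complex.exp (Complex.I * (μ i * t)) + ∑ i ∈ S, c i *
            (Complex.exp (Complex.I * (μ i * t)) * Complex.exp (Complex.I * (μ i * u)))) / 2 := by
        rw [← Finset.sum_add_distrib, Finset.sum_div]
        exact Finset.sum_congr rfl fun i _ => by ring
      rw [this]
      ring
    rw [key, norm_div, Complex.norm_ofNat]
    have := norm_add_le (c₀ + ∑ i ∈ insert k S, c i * Complex.exp (Complex.I * (μ i * t)))
      (c₀ + ∑ i ∈ insert k S, c i * Complex.exp (Complex.I * (μ i * ((t + u : ℝ) : ℂ))))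
    linarith [h t, h (t + u)]

theorem card_piAntidiag_univ_le {K : Type*} [Fintype K] [DecidableEq K] (N : ℕ) :
    (Finset.piAntidiag (Finset.univ : Finset K) N).card ≤ (N + 1) ^ Fintype.card K := by
  have hsub : Finset.piAntidiag (Finset.univ : Finset K) N ⊆
      Fintype.piFinset fun _ => Finset.range (N + 1) := by
    intro a ha
    rw [Finset.mem_piAntidiag] at ha
    rw [Fintype.mem_piFinset]
    intro k
    rw [Finset.mem_range, Nat.lt_succ_iff, ← ha.1]
    exact Finset.single_le_sum (fun _ _ => Nat.zero_le _) (Finset.mem_univ k)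
  refine (Finset.card_le_card hsub).trans ?_
  simp

theorem eq_one_le_of_forall_one_le_pow_mul_pow (m : ℕ) (r : ℝ) (hr : 0 ≤ r)
    (h : ∀ N : ℕ, 1 ≤ ((N : ℝ) + 1) ^ m * r ^ N) : 1 ≤ r := by
  by_contra! hlt
  -- The factor `2 ^ m` absorbs `N + 1 ≤ 2N`, valid for `N ≥ 1`.
  have hlim := (tendsto_pow_const_mul_const_pow_of_abs_lt_one m
    (by rwa [abs_of_nonneg hr] : |r| < 1)).const_mul ((2 : ℝ) ^ m)
  rw [mul_zero] at hlim
  obtain ⟨N, hN, hN1⟩ := ((hlim.eventually_lt_const one_pos).and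
    (Filter.eventually_ge_atTop 1)).exists
  have h1 : ((N : ℝ) + 1) ^ m * r ^ N ≤ 2 ^ m * ((N : ℝ) ^ m * r ^ N) := by
    rw [← mul_assoc, ← mul_pow]
    have : (1 : ℝ) ≤ N := by exact_mod_cast hN1
    gcongr
    linarith
  linarith [h N]

/-- A weighted sum of signed characters of `ℝ` comes arbitrarily close to modulus one, provided
that the signs respect all balanced integer relations between the frequencies. -/
theorem exists_norm_signed_exp_sum_gt {K : Type*} [Fintype K] (w : K → ℝ)
    (hw : ∀ k, 0 ≤ w k) (hw1 : ∑ k, w k = 1) (s : K → ℕ) (μ : K → ℝ)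
    (hrel : ∀ l : K → ℤ, ∑ k, l k = 0 → ∑ k, (l k : ℝ) * μ k = 0 → Even (∑ k, l k * (s k : ℤ)))
    (ε : ℝ) (hε : 0 < ε) :
    ∃ t : ℝ, 1 - ε < ‖∑ k, (w k : ℂ) * (-1) ^ s k * Complex.exp (-(Complex.I * (t : ℂ)) * μ k)‖ := by
  classical
  by_contra! hcon
  have hr : 0 ≤ 1 - ε := (norm_nonneg _).trans (hcon 0)
  suffices h : 1 ≤ 1 - ε by linarith
  -- In the `N`-th power, each multinomial weight `M a` will be at most `(1 - ε) ^ N`. These weights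
  -- sum to 1 and are only polynomially many in `N`.
  refine eq_one_le_of_forall_one_le_pow_mul_pow (Fintype.card K) _ hr fun N => ?_
  let A := Finset.piAntidiag (Finset.univ : Finset K) N
  let M : (K → ℕ) → ℝ := fun a => (Nat.multinomial Finset.univ a : ℝ) * ∏ k, w k ^ a k
  have hM : ∀ a, 0 ≤ M a := fun a =>
    mul_nonneg (Nat.cast_nonneg _) (Finset.prod_nonneg fun k _ => pow_nonneg (hw k) _)
  let F : (K → ℕ) → ℝ := fun a => ∑ k, (a k : ℝ) * μ k
  let sg : (K → ℕ) → ℕ := fun a => ∑ k, a k * s k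
  have hexpand : ∀ t : ℝ, (∑ k, (w k : ℂ) * (-1) ^ s k *
      Complex.exp (-(Complex.I * (t : ℂ)) * μ k)) ^ N =
      ∑ a ∈ A, (M a : ℂ) * (-1) ^ sg a * Complex.exp (-(Complex.I * (t : ℂ)) * F a) := by
    intro t
    rw [Finset.sum_pow_eq_sum_piAntidiag]
    refine Finset.sum_congr rfl fun a _ => ?_
    simp only [mul_pow, Finset.prod_mul_distrib, M, sg, F]
    push_cast
    rw [Finset.mul_sum, Complex.exp_sum, ← Finset.prod_pow_eq_pow_sum]
    have h1 : ∀ k, Complex.exp (-(Complex.I * (t : ℂ)) * μ k) ^ a k =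
        Complex.exp (-(Complex.I * (t : ℂ)) * ((a k : ℂ) * μ k)) := fun k => by
      rw [← Complex.exp_nat_mul]; congr 1; ring
    have h2 : ∀ k, ((-1 : ℂ) ^ s k) ^ a k = (-1) ^ (a k * s k) := fun k => by
      rw [← pow_mul, mul_comm]
    simp_rw [h1, h2]
    ring
  have hbound : ∀ a₀ ∈ A, M a₀ ≤ (1 - ε) ^ N := by
    intro a₀ ha₀
    -- Two exponent vectors with the same total and the same frequency differ by a balanced
    -- relation, so terms of equal frequency never cancel.
    have hsign : ∀ a ∈ A.filter (fun a => F a = F a₀), (-1 : ℂ) ^ sg a = (-1) ^ sg a₀ := by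
      intro a ha
      obtain ⟨ha, hF⟩ := Finset.mem_filter.1 ha
      have hs1 := (Finset.mem_piAntidiag.1 ha).1
      have hs0 := (Finset.mem_piAntidiag.1 ha₀).1
      have hev := hrel (fun k => (a k : ℤ) - a₀ k)
        (by
          rw [Finset.sum_sub_distrib, ← Nat.cast_sum, ← Nat.cast_sum]
          exact sub_eq_zero.2 (congrArg _ (hs1.trans hs0.symm)))
        (by
          push_cast
          simp_rw [sub_mul]
          rw [Finset.sum_sub_distrib]
          exact sub_eq_zero.2 hF)
      have hev' : Even ((sg a : ℤ) - sg a₀) := by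
        convert hev using 1
        simp only [sg, sub_mul, Finset.sum_sub_distrib]
        push_cast
        rfl
      rw [Int.even_sub, Int.even_coe_nat, Int.even_coe_nat] at hev'
      rcases Nat.even_or_odd (sg a₀) with h | h
      · rw [h.neg_one_pow, (hev'.2 h).neg_one_pow]
      · rw [h.neg_one_pow, Odd.neg_one_pow]
        rw [← Nat.not_even_iff_odd] at h ⊢
        exact fun h' => h (hev'.1 h')
    -- Multiplying by the unimodular `exp(i F(a₀) t)` turns the terms of frequency `F a₀` into the
    -- constant term.
    have hc := norm_const_le_of_exp_sum_bounded (A.filter fun a => F a ≠ F a₀)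
      (fun a => F a₀ - F a) (fun a ha => sub_ne_zero.2 (Finset.mem_filter.1 ha).2.symm)
      (∑ a ∈ A.filter (fun a => F a = F a₀), (M a : ℂ) * (-1) ^ sg a)
      (fun a => (M a : ℂ) * (-1) ^ sg a) ((1 - ε) ^ N) (fun t => by
        have h1 := pow_le_pow_left₀ (norm_nonneg _) (hcon t) N
        rw [← norm_pow, hexpand] at h1
        have h2 : ‖Complex.exp (Complex.I * ((F a₀ * t : ℝ) : ℂ))‖ = 1 := by
          rw [mul_comm]; exact Complex.norm_exp_ofReal_mul_I _
        replace h1 := (norm_mul _ _).trans_le ((congrArg (· * _) h2).trans_le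
          ((one_mul _).trans_le h1))
        rw [Finset.mul_sum, ← Finset.sum_filter_add_sum_filter_not A (fun a => F a = F a₀)] at h1
        refine le_of_eq_of_le ?_ h1
        congr 2
        · refine Finset.sum_congr rfl fun a ha => ?_
          rw [(Finset.mem_filter.1 ha).2, mul_left_comm, ← Complex.exp_add]
          have : Complex.I * ((F a₀ * t : ℝ) : ℂ) + -(Complex.I * (t : ℂ)) * (F a₀ : ℂ) = 0 := by
            push_cast; ring
          rw [this, Complex.exp_zero, mul_one]
        · refine Finset.sum_congr rfl fun a _ => ?_
          rw [mul_left_comm (Complex.exp _), ← Complex.exp_add]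
          congr 2
          push_cast
          ring)
    rw [Finset.sum_congr rfl fun a ha => by rw [hsign a ha], ← Finset.sum_mul, norm_mul,
      norm_pow, norm_neg, norm_one, one_pow, mul_one, ← Complex.ofReal_sum, Complex.norm_real,
      Real.norm_eq_abs] at hc
    refine le_trans ?_ ((le_abs_self _).trans hc)
    exact Finset.single_le_sum (fun a _ => hM a) (Finset.mem_filter.2 ⟨ha₀, rfl⟩)
  have hone : ∑ a ∈ A, M a = 1 := by
    have := Finset.sum_pow_eq_sum_piAntidiag (Finset.univ : Finset K) w N
    rw [hw1, one_pow] at this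
    exact this.symm
  calc (1 : ℝ) = ∑ a ∈ A, M a := hone.symm
    _ ≤ A.card • (1 - ε) ^ N := Finset.sum_le_card_nsmul _ _ _ hbound
    _ = (A.card : ℝ) * (1 - ε) ^ N := nsmul_eq_mul _ _
    _ ≤ ((N : ℝ) + 1) ^ Fintype.card K * (1 - ε) ^ N := by
      gcongr
      exact_mod_cast card_piAntidiag_univ_le N

/-! ### Rational relations between powers of a root of unity -/

open Polynomial in
theorem _root_.IsPrimitiveRoot.coeff_eq_zero_of_sum_eq_zero {N : ℕ} (hN : 0 < N) {ζ : ℂ}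
    (hζ : IsPrimitiveRoot ζ N) (d : ℕ → ℚ)
    (h : ∑ k ∈ Finset.range N.totient, (d k : ℂ) * ζ ^ k = 0) :
    ∀ k < N.totient, d k = 0 := by
  have hli := linearIndependent_pow (K := ℚ) ζ
  rw [← cyclotomic_eq_minpoly_rat hζ hN, natDegree_cyclotomic, Fintype.linearIndependent_iff] at hli
  intro k hk
  refine hli (fun i => d i) ?_ ⟨k, hk⟩
  rw [← h, ← Fin.sum_univ_eq_sum_range (fun k => (d k : ℂ) * ζ ^ k)]
  exact Finset.sum_congr rfl fun i _ => by rw [Rat.smul_def]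

/-- Subtracting `d (p - 1)` times `1 + ω + ⋯ + ω^(p-1) = 0` leaves a relation between the first `p -
1` powers, which are independent. -/
theorem _root_.IsPrimitiveRoot.coeff_eq_of_prime {p : ℕ} (hp : p.Prime) {ω : ℂ}
    (hω : IsPrimitiveRoot ω p) (d : ℕ → ℚ)
    (h : ∑ k ∈ Finset.range p, (d k : ℂ) * ω ^ k = 0) :
    ∀ k < p, d k = d 0 := by
  have hgeom := hω.geom_sum_eq_zero hp.one_lt
  have h1 : ∑ k ∈ Finset.range p.totient, ((d k - d (p - 1) : ℚ) : ℂ) * ω ^ k = 0 := by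
    have h2 : ∑ k ∈ Finset.range p, ((d k - d (p - 1) : ℚ) : ℂ) * ω ^ k = 0 := by
      push_cast
      simp_rw [sub_mul]
      rw [Finset.sum_sub_distrib, h, ← Finset.mul_sum, hgeom, mul_zero, sub_zero]
    rw [Nat.totient_prime hp]
    obtain ⟨m, rfl⟩ : ∃ m, p = m + 1 := ⟨p - 1, (Nat.sub_add_cancel hp.one_le).symm⟩
    rw [Finset.sum_range_succ] at h2
    simpa using h2
  have h3 := hω.coeff_eq_zero_of_sum_eq_zero hp.pos _ h1
  rw [Nat.totient_prime hp] at h3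
  have h4 : ∀ k < p, d k = d (p - 1) := fun k hk => by
    rcases Nat.lt_or_ge k (p - 1) with hk' | hk'
    · exact sub_eq_zero.1 (h3 k hk')
    · rw [show k = p - 1 by omega]
  exact fun k hk => (h4 k hk).trans (h4 0 hp.pos).symm

/-! ### Parity of integer relations between the numbers 2cos(πj/m) -/

theorem exists_primitiveRoot_two_cos (m : ℕ) (hm : 0 < m) :
    ∃ ζ : ℂ, IsPrimitiveRoot ζ (2 * m) ∧ ζ ^ m = -1 ∧
      ∀ j : ℕ, ((2 * Real.cos (Real.pi * j / m) : ℝ) : ℂ) = ζ ^ j + (ζ ^ j)⁻¹ := by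
  have hm0 : (m : ℂ) ≠ 0 := Nat.cast_ne_zero.2 hm.ne'
  refine ⟨Complex.exp (2 * Real.pi * Complex.I / (2 * m : ℕ)),
    Complex.isPrimitiveRoot_exp _ (by omega), ?_, fun j => ?_⟩
  · rw [← Complex.exp_nat_mul, ← Complex.exp_pi_mul_I]
    congr 1
    push_cast
    field_simp
  · rw [← Complex.exp_nat_mul, ← Complex.exp_neg]
    push_cast
    rw [Complex.two_cos]
    congr 2 <;> · field_simp

theorem sum_range_succ_reflect_mul (m : ℕ) (α : ℕ → ℤ) (ω : ℂ) :
    ∑ j ∈ Finset.range (m + 1), (α j : ℂ) * ω ^ (m - j) =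
      ∑ j ∈ Finset.range (m + 1), (α (m - j) : ℂ) * ω ^ j := by
  rw [← Finset.sum_range_reflect]
  refine Finset.sum_congr rfl fun j hj => ?_
  have := Finset.mem_range.1 hj
  rw [Nat.add_sub_cancel, Nat.sub_sub_self (by omega)]

/-- With `ω = -ζ` of order `p`, `2cos(πj/p) = (-1)^j (ω^j + ω^(p-j))`. Setting `β_j = (-1)^j α_j`,
the coefficient `β_k + β_(p-k)` of `ω^k` is therefore the same for all `1 ≤ k < p`; summing over `k`
gives the multiple of `p - 1`. -/
theorem exists_alternating_sum_eq_of_prime {p : ℕ} (hp : p.Prime) (hodd : Odd p) (α : ℕ → ℤ)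
    (h0 : α 0 = 0) (hpα : α p = 0) (q : ℚ)
    (h : ∑ j ∈ Finset.range (p + 1), (α j : ℂ) * ((2 * Real.cos (Real.pi * j / p) : ℝ) : ℂ) = q) :
    ∃ c : ℤ, 2 * ∑ j ∈ Finset.range (p + 1), (-1) ^ j * α j = c * (p - 1) := by
  obtain ⟨ζ, hζ, hζp, hcos⟩ := exists_primitiveRoot_two_cos p hp.pos
  have hωp : (-ζ) ^ p = 1 := by rw [hodd.neg_pow, hζp, neg_neg]
  have hω1 : -ζ ≠ 1 := by
    intro hc
    have h2 : ζ ^ 2 = 1 := by rw [← neg_sq, hc, one_pow]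
    have h3 := Nat.le_of_dvd two_pos (hζ.dvd_of_pow_eq_one 2 h2)
    have := hp.two_le
    omega
  have hω : IsPrimitiveRoot (-ζ) p := by
    have := Fact.mk hp
    rw [← orderOf_eq_prime hωp hω1]
    exact IsPrimitiveRoot.orderOf _
  have hω0 : -ζ ≠ 0 := hω.ne_zero hp.ne_zero
  let β : ℕ → ℤ := fun j => (-1) ^ j * α j
  have hterm : ∀ j ∈ Finset.range (p + 1),
      (α j : ℂ) * ((2 * Real.cos (Real.pi * j / p) : ℝ) : ℂ) =
        (β j : ℂ) * (-ζ) ^ j + (β j : ℂ) * (-ζ) ^ (p - j) := by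
    intro j hj
    have hj' : j ≤ p := Nat.lt_succ_iff.1 (Finset.mem_range.1 hj)
    have h1 : (-ζ) ^ (p - j) = ((-ζ) ^ j)⁻¹ := by
      rw [pow_sub₀ _ hω0 hj', hωp, one_mul]
    have h2 : ζ ^ j = (-1) ^ j * (-ζ) ^ j := by rw [← mul_pow]; simp
    rw [hcos, h1, h2, mul_inv, ← inv_pow, inv_neg, inv_one]
    simp only [β]
    push_cast
    ring
  have hβ0 : β 0 = 0 := by simp [β, h0]
  have hβp : β p = 0 := by simp [β, hpα]
  rw [Finset.sum_congr rfl hterm, Finset.sum_add_distrib, sum_range_succ_reflect_mul,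
    ← Finset.sum_add_distrib, Finset.sum_range_succ, Nat.sub_self, hβ0, hβp] at h
  simp only [Int.cast_zero, zero_mul, add_zero, ← add_mul] at h
  -- The rational value `q` is absorbed into the coefficient of `ω^0`, which becomes `-q`.
  have hcoef := hω.coeff_eq_of_prime hp
    (fun k => (β k : ℚ) + β (p - k) - if k = 0 then q else 0) (by
      rw [Finset.sum_congr rfl (g := fun k => ((β k : ℂ) + β (p - k)) * (-ζ) ^ k -
        (if k = 0 then (q : ℂ) else 0) * (-ζ) ^ k)
        (fun k _ => by split_ifs <;> push_cast <;> ring), Finset.sum_sub_distrib, h]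
      simp [hp.pos, ite_mul])
  have hcoef' : ∀ k, 1 ≤ k → k < p → (β k : ℚ) + β (p - k) = -q := by
    intro k hk1 hk
    have := hcoef k hk
    simpa [hβ0, hβp, Nat.one_le_iff_ne_zero.1 hk1] using this
  refine ⟨β 1 + β (p - 1), ?_⟩
  have hc1 := hcoef' 1 le_rfl hp.one_lt
  have hrefl : ∑ j ∈ Finset.range (p + 1), β (p - j) = ∑ j ∈ Finset.range (p + 1), β j := by
    rw [← Finset.sum_range_reflect β]
    rfl
  have hsum : ∑ j ∈ Finset.range (p + 1), (β j + β (p - j)) =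
      (β 1 + β (p - 1)) * ((p : ℤ) - 1) := by
    rw [Finset.sum_range_succ]
    obtain ⟨m, rfl⟩ : ∃ m, p = m + 1 := ⟨p - 1, (Nat.sub_add_cancel hp.one_le).symm⟩
    rw [Finset.sum_range_succ', Finset.sum_congr rfl (g := fun _ => β 1 + β (m + 1 - 1))]
    · simp [hβ0, hβp]; ring
    · intro k hk
      have := hcoef' (k + 1) (by omega) (by have := Finset.mem_range.1 hk; omega)
      exact_mod_cast this.trans hc1.symm
  rw [Finset.sum_add_distrib, hrefl] at hsum
  rw [two_mul]
  exact hsum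

/-- The indicator of the even numbers. -/
def evenInd (j : ℕ) : ℕ := if Even j then 1 else 0

theorem sum_range_evenInd {R : Type*} [CommRing R] (m : ℕ) (g : ℕ → R) :
    ∑ j ∈ Finset.range (2 * m + 1), (evenInd j : R) * g j =
      ∑ k ∈ Finset.range (m + 1), g (2 * k) := by
  induction m with
  | zero => simp [evenInd]
  | succ m ih =>
    rw [show 2 * (m + 1) + 1 = 2 * m + 1 + 1 + 1 by ring, Finset.sum_range_succ,
      Finset.sum_range_succ, ih, Finset.sum_range_succ _ (m + 1)]
    have h1 : evenInd (2 * m + 1) = 0 := by simp [evenInd]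
    have h2 : evenInd (2 * m + 1 + 1) = 1 := by
      rw [evenInd, if_pos]
      exact ⟨m + 1, by ring⟩
    rw [h1, h2]
    simp [mul_add]

/-- Adding the zero total to the alternating sum gives twice the even-index sum. Hence four times
the latter is `c (p - 1)`, a multiple of 8. -/
theorem even_sum_evenInd_of_prime {p : ℕ} (hp : p.Prime) (hmod : p ≡ 1 [MOD 8]) (α : ℕ → ℤ)
    (h0 : α 0 = 0) (hpα : α p = 0) (hsum : ∑ j ∈ Finset.range (p + 1), α j = 0) (q : ℚ)
    (h : ∑ j ∈ Finset.range (p + 1), (α j : ℂ) * ((2 * Real.cos (Real.pi * j / p) : ℝ) : ℂ) = q) :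
    Even (∑ j ∈ Finset.range (p + 1), α j * (evenInd j : ℤ)) := by
  have hp8 : p % 8 = 1 := hmod
  obtain ⟨c, hc⟩ := exists_alternating_sum_eq_of_prime hp (Nat.odd_iff.2 (by omega)) α h0 hpα q h
  have h1 : ∑ j ∈ Finset.range (p + 1), (-1) ^ j * α j + ∑ j ∈ Finset.range (p + 1), α j =
      2 * ∑ j ∈ Finset.range (p + 1), α j * (evenInd j : ℤ) := by
    rw [← Finset.sum_add_distrib, Finset.mul_sum]
    refine Finset.sum_congr rfl fun j _ => ?_
    rcases Nat.even_or_odd j with hj | hj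
    · rw [hj.neg_one_pow, evenInd, if_pos hj]; push_cast; ring
    · rw [hj.neg_one_pow, evenInd, if_neg (Nat.not_even_iff_odd.2 hj)]; push_cast; ring
  have hp' : (p : ℤ) - 1 = 8 * ((p / 8 : ℕ) : ℤ) := by omega
  rw [hp'] at hc
  refine ⟨c * ((p / 8 : ℕ) : ℤ), ?_⟩
  linarith

/-- The conjugation `ζ ↦ -ζ` of primitive `4p`-th roots negates the odd-index terms, so averaging
leaves a relation on even indices, that is, one for `p`. There the alternating sum is even, and it
has the parity of the plain sum. -/
theorem even_sum_evenInd_of_two_mul_prime {p : ℕ} (hp : p.Prime) (hmod : p ≡ 1 [MOD 4])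
    (α : ℕ → ℤ) (h0 : α 0 = 0) (hpα : α (2 * p) = 0) (q : ℚ)
    (h : ∑ j ∈ Finset.range (2 * p + 1),
      (α j : ℂ) * ((2 * Real.cos (Real.pi * j / (2 * p : ℕ)) : ℝ) : ℂ) = q) :
    Even (∑ j ∈ Finset.range (2 * p + 1), α j * (evenInd j : ℤ)) := by
  have hp4 : p % 4 = 1 := hmod
  obtain ⟨ζ, hζ, hζm, hcos⟩ := exists_primitiveRoot_two_cos (2 * p) (by have := hp.pos; omega)
  have hN : 0 < 2 * (2 * p) := by have := hp.pos; omega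
  have hζ0 : ζ ≠ 0 := hζ.ne_zero hN.ne'
  have hneg : IsPrimitiveRoot (-ζ) (2 * (2 * p)) := by
    have h1 : -ζ = ζ ^ (2 * p + 1) := by rw [pow_succ, hζm, neg_one_mul]
    rw [h1]
    refine hζ.pow_of_coprime _ ?_
    have h2 : Nat.Coprime (2 * p + 1) (2 * p) := by simp
    exact Nat.Coprime.mul_right (Nat.Coprime.coprime_mul_right_right h2) h2
  -- `X ^ (4p - j)` replaces the inverse of `X ^ j` at both roots and has an exponent of the same
  -- parity as `j`.
  let P : Polynomial ℚ := ∑ j ∈ Finset.range (2 * p + 1),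
    Polynomial.C (α j : ℚ) * (Polynomial.X ^ j + Polynomial.X ^ (2 * (2 * p) - j)) - Polynomial.C q
  have haeval : ∀ x : ℂ, Polynomial.aeval x P =
      ∑ j ∈ Finset.range (2 * p + 1), (α j : ℂ) * (x ^ j + x ^ (2 * (2 * p) - j)) - q := by
    intro x
    simp [P]
  have hterm : ∀ j ∈ Finset.range (2 * p + 1),
      (α j : ℂ) * ((2 * Real.cos (Real.pi * j / (2 * p : ℕ)) : ℝ) : ℂ) =
        (α j : ℂ) * (ζ ^ j + ζ ^ (2 * (2 * p) - j)) := by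
    intro j hj
    have := Finset.mem_range.1 hj
    rw [hcos, pow_sub₀ _ hζ0 (by omega), hζ.pow_eq_one, one_mul]
  have hP : Polynomial.aeval ζ P = 0 := by
    rw [haeval, ← Finset.sum_congr rfl hterm, h, sub_self]
  have hP' : Polynomial.aeval (-ζ) P = 0 := by
    refine Polynomial.aeval_eq_zero_of_dvd_aeval_eq_zero (minpoly.dvd ℚ ζ hP) ?_
    rw [← Polynomial.cyclotomic_eq_minpoly_rat hζ hN, Polynomial.cyclotomic_eq_minpoly_rat hneg hN]
    exact minpoly.aeval _ _
  have heven : ∑ j ∈ Finset.range (2 * p + 1), ((evenInd j : ℕ) : ℂ) *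
      ((α j : ℂ) * ((2 * Real.cos (Real.pi * j / (2 * p : ℕ)) : ℝ) : ℂ)) = q := by
    have h1 : ∑ j ∈ Finset.range (2 * p + 1), (α j : ℂ) * (ζ ^ j + ζ ^ (2 * (2 * p) - j)) +
        ∑ j ∈ Finset.range (2 * p + 1), (α j : ℂ) * ((-ζ) ^ j + (-ζ) ^ (2 * (2 * p) - j)) =
        2 * q := by
      rw [haeval] at hP hP'
      linear_combination hP + hP'
    rw [← mul_right_inj' (two_ne_zero' ℂ), ← h1, ← Finset.sum_add_distrib, Finset.mul_sum]
    refine Finset.sum_congr rfl fun j hj => ?_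
    rw [hterm j hj]
    have hjle := Finset.mem_range.1 hj
    rcases Nat.even_or_odd j with hj | hj
    · have hj' : Even (2 * (2 * p) - j) := by
        rw [Nat.even_iff] at *; omega
      rw [hj.neg_pow, hj'.neg_pow, evenInd, if_pos hj]; push_cast; ring
    · have hj' : Odd (2 * (2 * p) - j) := by
        rw [Nat.odd_iff] at *; omega
      rw [hj.neg_pow, hj'.neg_pow, evenInd, if_neg (Nat.not_even_iff_odd.2 hj)]; push_cast; ring
  rw [sum_range_evenInd] at heven
  obtain ⟨c, hc⟩ := exists_alternating_sum_eq_of_prime hp (Nat.odd_iff.2 (by omega))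
    (fun k => α (2 * k)) h0 hpα q (by
      rw [← heven]
      refine Finset.sum_congr rfl fun k _ => ?_
      congr 4
      push_cast
      rw [mul_left_comm, mul_div_mul_left _ _ two_ne_zero])
  have h2 : ∑ j ∈ Finset.range (2 * p + 1), α j * (evenInd j : ℤ) =
      ∑ k ∈ Finset.range (p + 1), α (2 * k) := by
    rw [← sum_range_evenInd]
    exact Finset.sum_congr rfl fun _ _ => mul_comm _ _
  have h3 : Even (∑ k ∈ Finset.range (p + 1), (α (2 * k) - (-1) ^ k * α (2 * k))) := by
    refine Finset.even_sum _ fun k _ => ?_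
    rcases Nat.even_or_odd k with hk | hk
    · rw [hk.neg_one_pow]; simp
    · rw [hk.neg_one_pow]; exact ⟨α (2 * k), by ring⟩
  rw [Finset.sum_sub_distrib, Int.even_sub] at h3
  rw [h2, h3]
  have hp' : (p : ℤ) - 1 = 4 * ((p / 4 : ℕ) : ℤ) := by omega
  rw [hp'] at hc
  refine ⟨c * ((p / 4 : ℕ) : ℤ), ?_⟩
  linarith

/-- Since `ζ^(-j) = -ζ^(m-j)` for `m = 2^e`, independence of `1, …, ζ^(m-1)` forces `α_k = α_(m-k)`.
The odd-index sum is then even, hence so is the even-index sum, the total being zero. -/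
theorem even_sum_evenInd_of_two_pow {e : ℕ} (he : 2 ≤ e) (α : ℕ → ℤ)
    (h0 : α 0 = 0) (hα : α (2 ^ e) = 0) (hsum : ∑ j ∈ Finset.range (2 ^ e + 1), α j = 0) (q : ℚ)
    (h : ∑ j ∈ Finset.range (2 ^ e + 1),
      (α j : ℂ) * ((2 * Real.cos (Real.pi * j / (2 ^ e : ℕ)) : ℝ) : ℂ) = q) :
    Even (∑ j ∈ Finset.range (2 ^ e + 1), α j * (evenInd j : ℤ)) := by
  obtain ⟨ζ, hζ, hζm, hcos⟩ := exists_primitiveRoot_two_cos (2 ^ e) (by positivity)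
  have hN : 0 < 2 * 2 ^ e := by positivity
  have hζ0 : ζ ≠ 0 := hζ.ne_zero hN.ne'
  have h4 : 2 ^ e % 4 = 0 := Nat.mod_eq_zero_of_dvd (pow_dvd_pow 2 he)
  have htot : (2 * 2 ^ e).totient = 2 ^ e := by
    rw [← pow_succ', Nat.totient_prime_pow_succ Nat.prime_two, show 2 - 1 = 1 from rfl, mul_one]
  generalize 2 ^ e = m at *
  have hm : 0 < m := by omega
  have hterm : ∀ j ∈ Finset.range (m + 1),
      (α j : ℂ) * ((2 * Real.cos (Real.pi * j / m) : ℝ) : ℂ) =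
        (α j : ℂ) * ζ ^ j - (α j : ℂ) * ζ ^ (m - j) := by
    intro j hj
    have := Finset.mem_range.1 hj
    rw [hcos, pow_sub₀ _ hζ0 (by omega), hζm]
    ring
  rw [Finset.sum_congr rfl hterm, Finset.sum_sub_distrib, sum_range_succ_reflect_mul,
    ← Finset.sum_sub_distrib, Finset.sum_range_succ, hα, Nat.sub_self, h0] at h
  simp only [Int.cast_zero, zero_mul, add_zero, sub_zero, ← sub_mul] at h
  have hcoef := hζ.coeff_eq_zero_of_sum_eq_zero hN
    (fun k => (α k : ℚ) - α (m - k) - if k = 0 then q else 0) (by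
      rw [htot]
      rw [Finset.sum_congr rfl (g := fun k => ((α k : ℂ) - α (m - k)) * ζ ^ k -
        (if k = 0 then (q : ℂ) else 0) * ζ ^ k)
        (fun k _ => by split_ifs <;> push_cast <;> ring), Finset.sum_sub_distrib, h]
      simp [hm, ite_mul])
  rw [htot] at hcoef
  have hsymm : ∀ k ≤ m, α k = α (m - k) := by
    intro k hk
    rcases Nat.eq_zero_or_pos k with rfl | hk0
    · simp [h0, hα]
    rcases hk.eq_or_lt with rfl | hk'
    · simp [h0, hα]
    have := hcoef k hk'
    rw [if_neg hk0.ne', sub_zero, sub_eq_zero] at this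
    exact_mod_cast this
  have hodd : ∑ j ∈ Finset.range (m + 1), ((α j * (1 - (evenInd j : ℤ)) : ℤ) : ZMod 2) = 0 := by
    -- The only fixed point `m / 2` is even because `4 ∣ m`, so its term vanishes.
    refine Finset.sum_involution (fun j _ => m - j) (fun j hj => ?_) (fun j hj hne => ?_)
      (fun j _ => Finset.mem_range.2 (by omega)) (fun j hj => ?_)
    · have hj' := Finset.mem_range.1 hj
      have : evenInd (m - j) = evenInd j := by
        unfold evenInd
        congr 1
        simp only [Nat.even_iff, eq_iff_iff]
        omega
      rw [this, ← hsymm j (by omega), CharTwo.add_self_eq_zero]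
    · have hj' := Finset.mem_range.1 hj
      intro heq
      apply hne
      have : Even j := by rw [Nat.even_iff]; omega
      simp [evenInd, this]
    · have hj' := Finset.mem_range.1 hj
      omega
  rw [← Int.cast_sum, ZMod.intCast_zmod_eq_zero_iff_dvd] at hodd
  simp_rw [mul_sub, mul_one] at hodd
  rw [Finset.sum_sub_distrib, hsum, zero_sub, dvd_neg] at hodd
  exact even_iff_two_dvd.2 (by exact_mod_cast hodd)

/-! ### Diagonalization of the two factors -/

theorem exp_smul_apply_of_diagonalization {K : Type*} [Fintype K] [DecidableEq K]
    (A Q R : Matrix K K ℂ) (d : K → ℂ) (hQR : Q * R = 1) (h : A * Q = Q * Matrix.diagonal d)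
    (c : ℂ) (a b : K) :
    NormedSpace.exp (c • A) a b = ∑ k, Q a k * Complex.exp (c * d k) * R k b := by
  have hinv : Q⁻¹ = R := Matrix.inv_eq_right_inv hQR
  have hA : c • A = Q * Matrix.diagonal (c • d) * Q⁻¹ := by
    rw [hinv, Matrix.diagonal_smul, Matrix.mul_smul, Matrix.smul_mul, ← h, Matrix.mul_assoc, hQR,
      Matrix.mul_one]
  rw [hA, Matrix.exp_conj _ _ (IsUnit.of_mul_eq_one _ hQR), Matrix.exp_diagonal, hinv,
    Matrix.mul_apply]
  refine Finset.sum_congr rfl fun k _ => ?_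
  rw [Matrix.mul_diagonal, Pi.coe_exp, ← Complex.exp_eq_exp_ℂ, Pi.smul_apply, smul_eq_mul]

/-- `Sᵀ S` commutes with a diagonal matrix with distinct entries, so it is diagonal. This inverts
the sine matrix without evaluating trigonometric sums. -/
theorem inv_gram_mul_transpose_mul {K : Type*} [Fintype K] [DecidableEq K] (A S : Matrix K K ℝ)
    (d : K → ℝ) (hA : Aᵀ = A) (hd : Function.Injective d) (h : A * S = S * Matrix.diagonal d)
    (hS : ∀ j, ∃ k, S k j ≠ 0) :
    Matrix.diagonal (fun j => (∑ k, S k j ^ 2)⁻¹) * Sᵀ * S = 1 := by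
  have hcomm : Sᵀ * S * Matrix.diagonal d = Matrix.diagonal d * (Sᵀ * S) := by
    have h1 : Sᵀ * A = Matrix.diagonal d * Sᵀ := by
      have := congrArg Matrix.transpose h
      rwa [Matrix.transpose_mul, Matrix.transpose_mul, hA, Matrix.diagonal_transpose] at this
    rw [Matrix.mul_assoc, ← h, ← Matrix.mul_assoc, h1, Matrix.mul_assoc]
  ext i j
  rw [Matrix.mul_assoc, Matrix.diagonal_mul]
  rcases eq_or_ne i j with rfl | hij
  · rw [Matrix.one_apply_eq, Matrix.mul_apply]
    simp_rw [Matrix.transpose_apply, ← sq]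
    refine inv_mul_cancel₀ (ne_of_gt ?_)
    obtain ⟨k, hk⟩ := hS i
    exact Finset.sum_pos' (fun k _ => sq_nonneg _) ⟨k, Finset.mem_univ _, by positivity⟩
  · rw [Matrix.one_apply_ne hij]
    have := congrFun (congrFun hcomm i) j
    rw [Matrix.mul_diagonal, Matrix.diagonal_mul, mul_comm] at this
    rw [(mul_eq_mul_right_iff.1 this).resolve_left fun h => hij (hd h).symm, mul_zero]

/-- The eigenvalues `2 cos (π (j + 1) / (n + 1))` of the path on `n` vertices. -/
noncomputable def pathEigenvalue (n : ℕ) (j : Fin n) : ℝ :=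
  2 * Real.cos (Real.pi * (j.val + 1 : ℕ) / (n + 1 : ℕ))

/-- The matrix of eigenvectors of the path on `n` vertices. -/
noncomputable def sineMatrix (n : ℕ) : Matrix (Fin n) (Fin n) ℝ :=
  Matrix.of fun k j => Real.sin ((k.val + 1 : ℕ) * (Real.pi * (j.val + 1 : ℕ) / (n + 1 : ℕ)))

/-- The zeros of `h` at `0` and `n + 1` stand in for the missing neighbours of the end vertices. -/
theorem sum_pathGraph_adj {n : ℕ} (k : Fin n) (h : ℕ → ℝ) (h0 : h 0 = 0) (hn : h (n + 1) = 0) :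
    ∑ l : Fin n, (if (SimpleGraph.pathGraph n).Adj k l then h (l + 1) else 0) =
      h k + h (k + 2) := by
  have h1 : ∀ l : Fin n, (if (SimpleGraph.pathGraph n).Adj k l then h (l + 1) else 0) =
      (if (k : ℕ) + 1 = l then h (l + 1) else 0) + if (l : ℕ) + 1 = k then h (l + 1) else 0 := by
    intro l
    simp only [SimpleGraph.pathGraph_adj]
    split_ifs <;> first | omega | simp
  rw [Finset.sum_congr rfl fun l _ => h1 l, Finset.sum_add_distrib, add_comm]
  congr 1
  · rw [Fin.sum_univ_eq_sum_range (fun l => if l + 1 = (k : ℕ) then h (l + 1) else 0)]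
    rcases hk : (k : ℕ) with _ | m
    · simp [h0]
    · have := k.isLt
      simp only [Nat.add_right_cancel_iff]
      rw [Finset.sum_ite_eq', if_pos (Finset.mem_range.2 (by omega))]
  · rw [Fin.sum_univ_eq_sum_range (fun l => if (k : ℕ) + 1 = l then h (l + 1) else 0),
      Finset.sum_ite_eq]
    split_ifs with hk
    · rfl
    · have := k.isLt
      rw [Finset.mem_range] at hk
      rw [show (k : ℕ) + 2 = n + 1 by omega, hn]

theorem adjMatrix_pathGraph_mul_sineMatrix (n : ℕ) :
    (SimpleGraph.pathGraph n).adjMatrix ℝ * sineMatrix n =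
      sineMatrix n * Matrix.diagonal (pathEigenvalue n) := by
  ext k j
  rw [Matrix.mul_apply, Matrix.mul_diagonal]
  set x : ℝ := Real.pi * (j.val + 1 : ℕ) / (n + 1 : ℕ) with hx
  have h1 := sum_pathGraph_adj k (fun m => Real.sin ((m : ℕ) * x)) (by simp) (by
    have : ((n + 1 : ℕ) : ℝ) * x = (j.val + 1 : ℕ) * Real.pi := by
      have : ((n + 1 : ℕ) : ℝ) ≠ 0 := by positivity
      rw [hx]; field_simp
    rw [this, Real.sin_nat_mul_pi])
  simp only [SimpleGraph.adjMatrix_apply, ite_mul, one_mul, zero_mul, sineMatrix, Matrix.of_apply,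
    pathEigenvalue]
  rw [h1, ← hx]
  have e1 : ((k : ℕ) : ℝ) * x = ((k.val + 1 : ℕ) : ℝ) * x - x := by push_cast; ring
  have e2 : ((k.val + 2 : ℕ) : ℝ) * x = ((k.val + 1 : ℕ) : ℝ) * x + x := by push_cast; ring
  rw [e1, e2, Real.sin_sub, Real.sin_add]
  ring

theorem angle_mem_Ioo {n : ℕ} (j : Fin n) :
    Real.pi * (j.val + 1 : ℕ) / (n + 1 : ℕ) ∈ Set.Ioo 0 Real.pi := by
  have hpi := Real.pi_pos
  have hj : ((j.val + 1 : ℕ) : ℝ) < (n + 1 : ℕ) := by exact_mod_cast Nat.succ_lt_succ j.isLt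
  refine ⟨by positivity, ?_⟩
  rw [div_lt_iff₀ (by positivity)]
  exact mul_lt_mul_of_pos_left hj hpi

theorem pathEigenvalue_injective (n : ℕ) : Function.Injective (pathEigenvalue n) := by
  intro i j hij
  have h1 := Real.injOn_cos (Set.Ioo_subset_Icc_self (angle_mem_Ioo i))
    (Set.Ioo_subset_Icc_self (angle_mem_Ioo j)) (mul_left_cancel₀ two_ne_zero hij)
  have h2 : ((n + 1 : ℕ) : ℝ) ≠ 0 := by positivity
  rw [div_left_inj' h2, mul_right_inj' Real.pi_ne_zero] at h1
  exact Fin.ext (by simpa using h1)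

theorem sineMatrix_first_pos {n : ℕ} (hn : 0 < n) (j : Fin n) :
    0 < sineMatrix n (firstVertex n hn) j := by
  have := angle_mem_Ioo j
  simp only [sineMatrix, firstVertex, Matrix.of_apply, zero_add, Nat.cast_one, one_mul]
  exact Real.sin_pos_of_pos_of_lt_pi this.1 this.2

theorem sineMatrix_last {n : ℕ} (hn : 0 < n) (j : Fin n) :
    sineMatrix n (lastVertex n hn) j = (-1) ^ (j : ℕ) * sineMatrix n (firstVertex n hn) j := by
  simp only [sineMatrix, firstVertex, lastVertex, Matrix.of_apply, zero_add, Nat.cast_one, one_mul]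
  rw [Nat.sub_add_cancel hn]
  set x : ℝ := Real.pi * (j.val + 1 : ℕ) / (n + 1 : ℕ) with hx
  have h1 : (n : ℝ) * x = (j.val + 1 : ℕ) * Real.pi - x := by
    have : ((n : ℝ) + 1) ≠ 0 := by positivity
    rw [hx]; push_cast; field_simp; ring
  rw [h1, Real.sin_nat_mul_pi_sub, pow_succ]
  ring

theorem exists_diagonalization_pathGraph {n : ℕ} (hn : 0 < n) :
    ∃ (Q R : Matrix (Fin n) (Fin n) ℂ) (w : Fin n → ℝ), Q * R = 1 ∧
      (SimpleGraph.pathGraph n).adjMatrix ℂ * Q =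
        Q * Matrix.diagonal (fun j => (pathEigenvalue n j : ℂ)) ∧
      (∀ j, 0 ≤ w j) ∧
      (∀ j, Q (firstVertex n hn) j * R j (firstVertex n hn) = w j) ∧
      ∀ j, Q (lastVertex n hn) j * R j (firstVertex n hn) = (-1) ^ (j : ℕ) * w j := by
  let S := sineMatrix n
  let T : Matrix (Fin n) (Fin n) ℝ := Matrix.diagonal (fun j => (∑ k, S k j ^ 2)⁻¹) * Sᵀ
  have hTS : S * T = 1 := mul_eq_one_comm.1 <| inv_gram_mul_transpose_mul _ S _
    (by simp) (pathEigenvalue_injective n)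
    (adjMatrix_pathGraph_mul_sineMatrix n) fun j => ⟨_, (sineMatrix_first_pos hn j).ne'⟩
  have hAmap : (SimpleGraph.pathGraph n).adjMatrix ℂ =
      ((SimpleGraph.pathGraph n).adjMatrix ℝ).map Complex.ofRealHom := by
    ext i j
    simp [SimpleGraph.adjMatrix_apply, apply_ite]
  have hT : ∀ j, T j (firstVertex n hn) =
      (∑ k, S k j ^ 2)⁻¹ * S (firstVertex n hn) j := fun j => by
    simp only [T, Matrix.diagonal_mul, Matrix.transpose_apply]
  refine ⟨S.map Complex.ofRealHom, T.map Complex.ofRealHom,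
    fun j => S (firstVertex n hn) j * T j (firstVertex n hn), ?_, ?_, fun j => ?_, fun j => ?_,
    fun j => ?_⟩
  · rw [← Matrix.map_mul, hTS, Matrix.map_one _ (map_zero _) (map_one _)]
  · rw [hAmap, ← Matrix.map_mul, adjMatrix_pathGraph_mul_sineMatrix, Matrix.map_mul,
      Matrix.diagonal_map (map_zero _)]
    rfl
  · have := sineMatrix_first_pos hn j
    simp only [hT]
    have h2 : 0 ≤ (∑ k, S k j ^ 2)⁻¹ := inv_nonneg.2 (Finset.sum_nonneg fun _ _ => sq_nonneg _)
    exact mul_nonneg this.le (mul_nonneg h2 this.le)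
  · simp
  · simp only [Matrix.map_apply, S, sineMatrix_last]
    simp [mul_assoc]

theorem exists_diagonalization_adjMatrix {V : Type*} [Fintype V] [DecidableEq V]
    (Z : SimpleGraph V) [DecidableRel Z.Adj] (z : V) :
    ∃ (Q R : Matrix V V ℂ) (v μ : V → ℝ), Q * R = 1 ∧
      Z.adjMatrix ℂ * Q = Q * Matrix.diagonal (fun r => (μ r : ℂ)) ∧
      (∀ r, 0 ≤ v r) ∧ (∀ r, Q z r * R r z = v r) ∧ ∀ r, (μ r : ℂ) ∈ eigenvalues Z := by
  have hA : (Z.adjMatrix ℂ).IsHermitian := by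
    ext i j
    simp [SimpleGraph.adjMatrix_apply, SimpleGraph.adj_comm, apply_ite]
  let Q : Matrix V V ℂ := hA.eigenvectorUnitary
  have hQ : Q * star Q = 1 := Unitary.coe_mul_star_self _
  refine ⟨Q, star Q, fun r => Complex.normSq (Q z r), hA.eigenvalues, hQ, ?_,
    fun r => Complex.normSq_nonneg _, fun r => ?_, fun r => ?_⟩
  · ext i r
    have := congrFun (hA.mulVec_eigenvectorBasis r) i
    rw [Matrix.mul_diagonal]
    simpa [Matrix.mul_apply, Matrix.mulVec, dotProduct, Q, mul_comm] using this
  · rw [Matrix.star_apply]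
    exact Complex.mul_conj _
  · refine Module.End.hasEigenvalue_of_hasEigenvector (x := hA.eigenvectorBasis r) ⟨?_, ?_⟩
    · rw [Module.End.mem_eigenspace_iff]
      ext i
      have := congrFun (hA.mulVec_eigenvectorBasis r) i
      simpa [adjOp] using this
    · exact hA.eigenvectorBasis.orthonormal.ne_zero r

theorem pathEigenvalue_mem_eigenvalues {n : ℕ} (j : Fin n) :
    (pathEigenvalue n j : ℂ) ∈ eigenvalues (SimpleGraph.pathGraph n) := by
  have hn : 0 < n := j.pos
  refine Module.End.hasEigenvalue_of_hasEigenvector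
    (x := WithLp.toLp 2 fun k => (sineMatrix n k j : ℂ)) ⟨?_, fun h => ?_⟩
  · rw [Module.End.mem_eigenspace_iff]
    ext i
    have := congrArg Complex.ofReal (congrFun (congrFun (adjMatrix_pathGraph_mul_sineMatrix n) i) j)
    rw [Matrix.mul_diagonal, Matrix.mul_apply] at this
    simp only [SimpleGraph.adjMatrix_apply] at this
    push_cast at this
    simpa [adjOp, Matrix.mulVec, dotProduct, SimpleGraph.adjMatrix_apply, mul_comm, apply_ite]
      using this
  · have := congrArg (fun x : EuclideanSpace ℂ (Fin n) => x (firstVertex n hn)) h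
    exact (sineMatrix_first_pos hn j).ne' (by simpa using this)

/-! ### The cartesian product and state transfer -/

theorem adjMatrix_boxProd {V W : Type*} [Fintype V] [DecidableEq V] [Fintype W] [DecidableEq W]
    (G : SimpleGraph V) (H : SimpleGraph W) [DecidableRel G.Adj] [DecidableRel H.Adj] :
    (SimpleGraph.boxProd G H).adjMatrix ℂ =
      G.adjMatrix ℂ ⊗ₖ (1 : Matrix W W ℂ) + (1 : Matrix V V ℂ) ⊗ₖ H.adjMatrix ℂ := by
  ext ⟨a, b⟩ ⟨c, d⟩
  simp only [SimpleGraph.adjMatrix_apply, SimpleGraph.boxProd_adj, Matrix.add_apply,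
    Matrix.kroneckerMap_apply, Matrix.one_apply]
  by_cases hac : a = c
  · subst hac
    by_cases hbd : b = d <;> simp [hbd]
  · by_cases hbd : b = d <;> simp [hac, hbd]

theorem adjMatrix_boxProd_mul_kronecker {V W : Type*} [Fintype V] [DecidableEq V] [Fintype W]
    [DecidableEq W] (G : SimpleGraph V) (H : SimpleGraph W) [DecidableRel G.Adj]
    [DecidableRel H.Adj] (Q : Matrix V V ℂ) (Q' : Matrix W W ℂ) (d : V → ℂ) (d' : W → ℂ)
    (hG : G.adjMatrix ℂ * Q = Q * Matrix.diagonal d)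
    (hH : H.adjMatrix ℂ * Q' = Q' * Matrix.diagonal d') :
    (SimpleGraph.boxProd G H).adjMatrix ℂ * (Q ⊗ₖ Q') =
      (Q ⊗ₖ Q') * Matrix.diagonal (fun x => d x.1 + d' x.2) := by
  rw [adjMatrix_boxProd, add_mul, ← Matrix.mul_kronecker_mul, ← Matrix.mul_kronecker_mul,
    Matrix.one_mul, Matrix.one_mul, hG, hH]
  ext ⟨a, b⟩ ⟨c, e⟩
  simp only [Matrix.add_apply, Matrix.kroneckerMap_apply, Matrix.mul_diagonal]
  ring

theorem transitionMatrix_symm {V : Type*} [Fintype V] [DecidableEq V] (G : SimpleGraph V)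
    [DecidableRel G.Adj] (t : ℝ) (a b : V) :
    transitionMatrix G t a b = transitionMatrix G t b a := by
  have : (transitionMatrix G t).IsSymm := by
    refine Matrix.IsSymm.exp ?_
    rw [Matrix.IsSymm, Matrix.transpose_smul, SimpleGraph.transpose_adjMatrix]
  exact this.apply b a

theorem even_sum_of_path_relation {n : ℕ} (hcases : (∃ p : ℕ, p.Prime ∧ p ≡ 1 [MOD 8] ∧ n + 1 = p) ∨
      (∃ p : ℕ, p.Prime ∧ p ≡ 1 [MOD 4] ∧ n + 1 = 2 * p) ∨
      (∃ e : ℕ, n + 1 = 2 ^ e))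
    (a : Fin n → ℤ) (hsum : ∑ j, a j = 0) (q : ℚ)
    (h : ∑ j, (a j : ℂ) * (pathEigenvalue n j : ℂ) = q) :
    Even (∑ j, a j * (evenInd (j + 1) : ℤ)) := by
  -- Shifting to indices `1, …, n` and padding by zero at `0` and `n + 1` makes the reflection `j ↦
  -- n + 1 - j` available.
  let α : ℕ → ℤ := fun j => if h : 1 ≤ j ∧ j ≤ n then a ⟨j - 1, by omega⟩ else 0
  have h0 : α 0 = 0 := by simp [α]
  have hn1 : α (n + 1) = 0 := by simp [α]
  have hα : ∀ j : Fin n, α (j + 1) = a j := fun j => by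
    have := j.isLt
    simp only [α]
    rw [dif_pos (by omega)]
    rfl
  have hZ : ∀ g : ℕ → ℤ, ∑ j ∈ Finset.range (n + 1 + 1), α j * g j = ∑ j, a j * g (j + 1) := by
    intro g
    rw [Finset.sum_range_succ, Finset.sum_range_succ', h0, hn1, Finset.sum_range]
    simp [hα]
  have hC : ∀ g : ℕ → ℂ, ∑ j ∈ Finset.range (n + 1 + 1), (α j : ℂ) * g j =
      ∑ j, (a j : ℂ) * g (j + 1) := by
    intro g
    rw [Finset.sum_range_succ, Finset.sum_range_succ', h0, hn1, Finset.sum_range]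
    simp [hα]
  have hs : ∑ j ∈ Finset.range (n + 1 + 1), α j = 0 := by
    have := hZ fun _ => 1
    simpa [hsum] using this
  have hq : ∑ j ∈ Finset.range (n + 1 + 1),
      (α j : ℂ) * ((2 * Real.cos (Real.pi * j / (n + 1 : ℕ)) : ℝ) : ℂ) = q := by
    rw [hC fun j => ((2 * Real.cos (Real.pi * j / (n + 1 : ℕ)) : ℝ) : ℂ)]
    exact h
  have hgoal := hZ fun j => (evenInd j : ℤ)
  rw [← hgoal]
  rcases hcases with ⟨p, hp, hmod, hnp⟩ | ⟨p, hp, hmod, hnp⟩ | ⟨e, hne⟩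
  · rw [hnp] at hs hq hn1 ⊢
    exact even_sum_evenInd_of_prime hp hmod α h0 hn1 hs q hq
  · rw [hnp] at hq hn1 ⊢
    exact even_sum_evenInd_of_two_mul_prime hp hmod α h0 hn1 q hq
  · rcases Nat.lt_or_ge e 2 with he | he
    · have hn2 : n + 1 ≤ 2 := by rw [hne]; interval_cases e <;> norm_num
      have hzero : ∀ j, a j = 0 := fun j => by
        have := j.isLt
        obtain rfl : n = 1 := by omega
        rw [Fin.sum_univ_one] at hsum
        rwa [Subsingleton.elim j 0]
      rw [hgoal]
      simp [hzero]
    · rw [hne] at hs hq hn1 ⊢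
      exact even_sum_evenInd_of_two_pow he α h0 hn1 hs q hq

theorem neg_one_pow_evenInd_succ (j : ℕ) : (-1 : ℂ) ^ evenInd (j + 1) = (-1) ^ j := by
  rcases Nat.even_or_odd j with hj | hj
  · rw [hj.neg_one_pow, evenInd, if_neg (Nat.not_even_iff_odd.2 hj.add_one), pow_zero]
  · rw [hj.neg_one_pow, evenInd, if_pos hj.add_one, pow_one]

theorem prettyGoodStateTransfer_boxProd_pathGraph {V : Type*} [Fintype V] [DecidableEq V]
    (Z : SimpleGraph V) [DecidableRel Z.Adj] (z : V) (n : ℕ) (hn : 0 < n)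
    (hcases : (∃ p : ℕ, p.Prime ∧ p ≡ 1 [MOD 8] ∧ n + 1 = p) ∨
      (∃ p : ℕ, p.Prime ∧ p ≡ 1 [MOD 4] ∧ n + 1 = 2 * p) ∨
      (∃ e : ℕ, n + 1 = 2 ^ e))
    (hfield : eigenvalueField (SimpleGraph.pathGraph n) ⊓ eigenvalueField Z = ⊥) :
    PrettyGoodStateTransfer (SimpleGraph.boxProd (SimpleGraph.pathGraph n) Z)
      (firstVertex n hn, z) (lastVertex n hn, z) := by
  intro ε hε
  obtain ⟨Q, R, w, hQR, hQ, hw0, hw, hw'⟩ := exists_diagonalization_pathGraph hn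
  obtain ⟨Q', R', v, μ, hQR', hQ', hv0, hv, hμ⟩ := exists_diagonalization_adjMatrix Z z
  have hw1 : ∑ j, w j = 1 := by
    have := congrFun (congrFun hQR (firstVertex n hn)) (firstVertex n hn)
    rw [Matrix.mul_apply, Matrix.one_apply_eq, Finset.sum_congr rfl fun j _ => hw j] at this
    exact_mod_cast this
  have hv1 : ∑ r, v r = 1 := by
    have := congrFun (congrFun hQR' z) z
    rw [Matrix.mul_apply, Matrix.one_apply_eq, Finset.sum_congr rfl fun j _ => hv j] at this
    exact_mod_cast this
  obtain ⟨t, ht⟩ := exists_norm_signed_exp_sum_gt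
    (fun x : Fin n × V => w x.1 * v x.2) (fun x => mul_nonneg (hw0 _) (hv0 _))
    (by rw [Fintype.sum_prod_type, ← Fintype.sum_mul_sum, hw1, hv1, one_mul])
    (fun x => evenInd (x.1 + 1)) (fun x => pathEigenvalue n x.1 + μ x.2)
    (fun l hl hlμ => by
      let a : Fin n → ℤ := fun j => ∑ r, l (j, r)
      let b : V → ℤ := fun r => ∑ j, l (j, r)
      have hsplit : ∑ j, (a j : ℂ) * (pathEigenvalue n j : ℂ) +
          ∑ r, (b r : ℂ) * (μ r : ℂ) = 0 := by
        have h1 := congrArg Complex.ofReal hlμ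
        push_cast at h1
        simp_rw [mul_add] at h1
        rw [Finset.sum_add_distrib, Fintype.sum_prod_type, Fintype.sum_prod_type_right] at h1
        simp only [a, b]
        push_cast
        simp_rw [Finset.sum_mul]
        exact h1
      have hmem : ∑ j, (a j : ℂ) * (pathEigenvalue n j : ℂ) ∈
          eigenvalueField (SimpleGraph.pathGraph n) ⊓ eigenvalueField Z := by
        refine ⟨sum_mem fun j _ => mul_mem (intCast_mem _ _) ?_, ?_⟩
        · exact IntermediateField.subset_adjoin _ _ (pathEigenvalue_mem_eigenvalues j)
        · rw [eq_neg_of_add_eq_zero_left hsplit]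
          exact neg_mem (sum_mem fun r _ => mul_mem (intCast_mem _ _)
            (IntermediateField.subset_adjoin _ _ (hμ r)))
      rw [hfield, IntermediateField.mem_bot] at hmem
      obtain ⟨q, hq⟩ := hmem
      have := even_sum_of_path_relation hcases a
        (by rw [← hl, Fintype.sum_prod_type]) q (by rw [← hq]; rfl)
      rw [Fintype.sum_prod_type]
      simp_rw [← Finset.sum_mul]
      exact this)
    ε hε
  refine ⟨t, ht.trans_eq ?_⟩
  rw [transitionMatrix, exp_smul_apply_of_diagonalization _ (Q ⊗ₖ Q') (R ⊗ₖ R') _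
    (by rw [← Matrix.mul_kronecker_mul, hQR, hQR', Matrix.one_kronecker_one])
    (adjMatrix_boxProd_mul_kronecker _ _ Q Q' _ _ hQ hQ')]
  congr 1
  refine Finset.sum_congr rfl fun x _ => ?_
  simp only [Matrix.kroneckerMap_apply]
  rw [neg_one_pow_evenInd_succ]
  push_cast
  linear_combination
    -(Complex.exp (-(Complex.I * (t : ℂ)) * (pathEigenvalue n x.1 + μ x.2))) *
      (Q' z x.2 * R' x.2 z * hw' x.1 + (-1) ^ (x.1 : ℕ) * w x.1 * hv x.2)

end QuantumWalk

theorem mainTheorem4 {V : Type*} [Fintype V] [DecidableEq V]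
    (Z : SimpleGraph V) [DecidableRel Z.Adj] (z : V) (n : ℕ) (hn : 0 < n)
    (hcases : (∃ p : ℕ, p.Prime ∧ p ≡ 1 [MOD 8] ∧ n + 1 = p) ∨
      (∃ p : ℕ, p.Prime ∧ p ≡ 1 [MOD 4] ∧ n + 1 = 2 * p) ∨
      (∃ e : ℕ, n + 1 = 2 ^ e))
    (hfield : QuantumWalk.eigenvalueField (SimpleGraph.pathGraph n) ⊓
      QuantumWalk.eigenvalueField Z = ⊥)
    (hsc : QuantumWalk.StronglyCospectral (SimpleGraph.boxProd (SimpleGraph.pathGraph n) Z)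
      (QuantumWalk.firstVertex n hn, z) (QuantumWalk.lastVertex n hn, z)) :
    QuantumWalk.PrettyGoodStateTransfer (SimpleGraph.boxProd (SimpleGraph.pathGraph n) Z)
      (QuantumWalk.firstVertex n hn, z) (QuantumWalk.lastVertex n hn, z) ∧
    QuantumWalk.PrettyGoodStateTransfer (SimpleGraph.boxProd (SimpleGraph.pathGraph n) Z)
      (QuantumWalk.lastVertex n hn, z) (QuantumWalk.firstVertex n hn, z) := by
  have h := QuantumWalk.prettyGoodStateTransfer_boxProd_pathGraph Z z n hn hcases hfield
  refine ⟨h, fun ε hε => ?_⟩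
  obtain ⟨τ, hτ⟩ := h ε hε
  exact ⟨τ, by rwa [QuantumWalk.transitionMatrix_symm]⟩
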